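/- Fix a sequence $(\mathbb T_N)_{N}$ of time grids $\mathbb T_N=\{t_0,t_1,\dots\}$, $0=t_0<t_1<\cdots$, $t_i\to\infty$ (the points depend on $N$), with $\mathbb T_1\subset\mathbb T_2\subset\cdots$ and $\lim_N\sup_{t_i\in\mathbb T_N}|t_{i+1}-t_i|=0$. For functions $\boldsymbol\xi,\boldsymbol X:[0,\infty)\to\mathbb R^d$ the pathwise Itô integral is $$\int_0^t\boldsymbol\xi_s\,d\boldsymbol X_s:=\lim_{N\uparrow\infty}\sum_{t_i,t_{i+1}\in\mathbb T_N,\ t_{i+1}\le t}\boldsymbol\xi_{t_i}\cdot(\boldsymbol X_{t_{i+1}}-\boldsymbol X_{t_i}),$$ provided the limit exists. Let $C^{1,2}(\mathbb R^n\times\mathbb R^d)$ be the class of functions $f(\boldsymbol a,\boldsymbol x)$ that are continuously differentiable in $(\boldsymbol a,\boldsymbol x)$ and twice differentiable in $\boldsymbol x$ with second partial derivatives $f_{x^kx^m}$ that are continuous in $(\boldsymbol a,\boldsymbol x)$. A function $\boldsymbol\xi:[0,\infty)\to\mathbb R^d$ is called an admissible integrand for $\boldsymbol X:[0,\infty)\to\mathbb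 R^d$ if for each $S>0$ there are $n\in\mathbb N$, $f\in C^{1,2}(\mathbb R^n\times\mathbb R^d)$ and a continuous function $\boldsymbol A:[0,\infty)\to\mathbb R^n$ whose components are of finite variation on $[0,S]$ such that $\boldsymbol\xi_t=\nabla_{\boldsymbol x}f(\boldsymbol A_t,\boldsymbol X_t)$ for $0\le t\le S$. **Theorem (associativity of the pathwise Itô integral).** Let $\boldsymbol X:[0,\infty)\to\mathbb R^d$ be continuous, and suppose that for all $k,m\in\{1,\dots,d\}$ and $t\ge 0$ the limit $$[X^k,X^m]_t=\lim_{N\uparrow\infty}\sum_{t_i,t_{i+1}\in\mathbb T_N,\ t_{i+1}\le t}(X^k_{t_{i+1}}-X^k_{t_i})(X^m_{t_{i+1}}-X^m_{t_i})$$ exists and is continuous in $t$. Let $\boldsymbol\xi^{(1)},\dots,\boldsymbol\xi^{(\nu)}$ be admissible integrands for $\boldsymbol X$. Then the integrals $$Y^\ell_t:=\int_0^t\boldsymbol\xi^{(\ell)}_s\,d\boldsymbol X_s,\qquad t\ge0,\ \ell=1,\dots,\nu,$$ exist. Let $\boldsymbol Y=(Y^1,\dots,Y^\nu)$, and let $\boldsymbol\eta=(\eta^1,\dots,\eta^\nu)$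 be an admissible integrand for $\boldsymbol Y$. Then $\sum_{\ell=1}^\nu\eta^\ell\boldsymbol\xi^{(\ell)}$ is an admissible integrand for $\boldsymbol X$, and for every $t\ge0$ both of the following integrals exist and $$\int_0^t\boldsymbol\eta_s\,d\boldsymbol Y_s=\int_0^t\sum_{\ell=1}^\nu\eta^\ell_s\boldsymbol\xi^{(\ell)}_s\,d\boldsymbol X_s.$$ -/

import Mathlib

open Filter Topology
open scoped NNReal

namespace PathwiseIto

/-- A time grid `0 = t_0 < t_1 < ⋯` in `[0, ∞)` with `t_i → ∞`. -/
structure TimeGrid where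
  /-- the grid point `t_i` -/
  pt : ℕ → ℝ≥0
  pt_zero : pt 0 = 0
  strictMono_pt : StrictMono pt
  tendsto_pt : Tendsto pt atTop atTop

theorem TimeGrid.finite_steps (G : TimeGrid) (t : ℝ≥0) : {i : ℕ | G.pt (i + 1) ≤ t}.Finite := by
  obtain ⟨n, hn⟩ := (G.tendsto_pt.eventually_gt_atTop t).exists
  refine (Set.finite_lt_nat n).subset fun i hi => ?_
  have h1 : G.pt (i + 1) < G.pt n := lt_of_le_of_lt hi hn
  have h2 : i + 1 < n := G.strictMono_pt.lt_iff_lt.mp h1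
  exact lt_trans (Nat.lt_succ_self i) h2

/-- The finitely many indices `i` with `t_{i+1} ≤ t`. -/
noncomputable def TimeGrid.steps (G : TimeGrid) (t : ℝ≥0) : Finset ℕ :=
  (G.finite_steps t).toFinset

/-- A refining sequence of time grids `𝕋_0 ⊆ 𝕋_1 ⊆ ⋯` whose mesh `sup_i |t_{i+1} - t_i|`
tends to zero. -/
structure GridSequence where
  /-- the `N`-th time grid -/
  grid : ℕ → TimeGrid
  refining : ∀ N, Set.range (grid N).pt ⊆ Set.range (grid (N + 1)).pt
  mesh : ∀ ε : ℝ, 0 < ε → ∀ᶠ N in atTop, ∀ i,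
    ((grid N).pt (i + 1) : ℝ) - ((grid N).pt i : ℝ) ≤ ε

/-- The sum `∑_{t_{i+1} ≤ t} (x_{t_{i+1}} - x_{t_i}) (y_{t_{i+1}} - y_{t_i})`. -/
noncomputable def covariationSum (G : TimeGrid) (x y : ℝ≥0 → ℝ) (t : ℝ≥0) : ℝ :=
  ∑ i ∈ G.steps t, (x (G.pt (i + 1)) - x (G.pt i)) * (y (G.pt (i + 1)) - y (G.pt i))

/-- `x` and `y` admit a continuous covariation `C = [x, y]` along the sequence of grids.
(For `t = 0` the sums are empty, so that `C 0 = 0`.) -/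
def HasContinuousCovariation (T : GridSequence) (x y : ℝ≥0 → ℝ) : Prop :=
  ∃ C : ℝ≥0 → ℝ, Continuous C ∧
    ∀ t, Tendsto (fun N => covariationSum (T.grid N) x y t) atTop (𝓝 (C t))

/-- `X : [0, ∞) → ℝ^d` is continuous and admits the continuous covariations `[X^k, X^m]` for all
`k` and `m`. -/
def IsIntegrator (T : GridSequence) {d : ℕ} (X : ℝ≥0 → EuclideanSpace ℝ (Fin d)) : Prop :=
  Continuous X ∧
    ∀ k m : Fin d, HasContinuousCovariation T (fun t => X t k) (fun t => X t m)

/-- The class `C^{1,2}(ℝ^n × ℝ^d)`: `f (a, x)` is continuously differentiable in `(a, x)` and twice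
differentiable in `x`, with second derivatives in `x` that are continuous in `(a, x)`. -/
def IsC12 {n d : ℕ} (f : EuclideanSpace ℝ (Fin n) → EuclideanSpace ℝ (Fin d) → ℝ) : Prop :=
  ContDiff ℝ 1 (Function.uncurry f) ∧
    (∀ a, ContDiff ℝ 2 (f a)) ∧
    Continuous (fun p : EuclideanSpace ℝ (Fin n) × EuclideanSpace ℝ (Fin d) =>
      fderiv ℝ (fderiv ℝ (f p.1)) p.2)

/-- `ξ` is an admissible integrand for `X`: on each `[0, S]` it is of the form
`ξ_t = ∇_x f (A_t, X_t)` with `f` of class `C^{1,2}` and `A` continuous with components of finite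
variation on `[0, S]`. -/
def IsAdmissible {d : ℕ} (X ξ : ℝ≥0 → EuclideanSpace ℝ (Fin d)) : Prop :=
  ∀ S : ℝ≥0, 0 < S →
    ∃ (n : ℕ) (f : EuclideanSpace ℝ (Fin n) → EuclideanSpace ℝ (Fin d) → ℝ)
      (A : ℝ≥0 → EuclideanSpace ℝ (Fin n)),
      IsC12 f ∧ Continuous A ∧
      (∀ k : Fin n, BoundedVariationOn (fun t => A t k) (Set.Icc 0 S)) ∧
      ∀ t, t ≤ S → ξ t = gradient (f (A t)) (X t)

/-- The nonanticipative Riemann sum `∑_{t_{i+1} ≤ t} ξ_{t_i} · (X_{t_{i+1}} - X_{t_i})`. -/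
noncomputable def riemannSum (G : TimeGrid) {d : ℕ} (ξ X : ℝ≥0 → EuclideanSpace ℝ (Fin d))
    (t : ℝ≥0) : ℝ :=
  ∑ i ∈ G.steps t, inner ℝ (ξ (G.pt i)) (X (G.pt (i + 1)) - X (G.pt i))

/-- The pathwise Itô integrals `∫_0^t ξ dX` exist for all `t ≥ 0`, as limits of Riemann sums. -/
def ItoIntegrable (T : GridSequence) {d : ℕ} (ξ X : ℝ≥0 → EuclideanSpace ℝ (Fin d)) : Prop :=
  ∀ t, ∃ I : ℝ, Tendsto (fun N => riemannSum (T.grid N) ξ X t) atTop (𝓝 I)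

/-- The pathwise Itô integral `∫_0^t ξ dX`, the limit of the Riemann sums along the grids. -/
noncomputable def itoIntegral (T : GridSequence) {d : ℕ} (ξ X : ℝ≥0 → EuclideanSpace ℝ (Fin d))
    (t : ℝ≥0) : ℝ :=
  limUnder atTop (fun N => riemannSum (T.grid N) ξ X t)

end PathwiseIto

open PathwiseIto

namespace PathwiseIto

/-! By the pathwise Itô formula each integral is, up to a correction, a function of its integrator:
on `[0, S]` one has Y^ℓ = f^ℓ(A^ℓ, X) - B^ℓ with B^ℓ continuous and of finite variation
(`exists_ito_decomposition`). If η = ∇g(C, Y), the chain rule therefore exhibits ∑ η^ℓ ξ^ℓ as the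
x-gradient of g(c, f(a, x) - b) at the parameters (C, A, B), which gives admissibility
(`exists_representation_sum_smul`).

The Riemann sums of the two integrals differ by ∑_ℓ ∑_i η^ℓ(t_i) w^ℓ_i with w^ℓ = ΔY^ℓ - ξ^ℓ·ΔX. By
Taylor's formula w^ℓ is of order |ΔA| + |ΔX|² + |ΔB|, so its absolute sums stay bounded in N, while
its cumulative sums up to any fixed time tend to 0. Approximating the continuous η by step functions
shows that the difference vanishes (`tendsto_weightedSum_zero`). Integrability of η against Y thus
comes from comparison with X: Itô's formula is used for X only, and no covariation of Y is needed.

The Itô formula rests on the same step-function argument, applied to the weights ΔA^k and ΔX^k ΔX^m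
(`exists_tendsto_weightedSum`), and on a Taylor estimate that is uniform on bounded sets
(`IsC12Map.exists_taylor_bound`). -/

/-! ### Grid indices and telescoping sums. -/

theorem TimeGrid.mem_steps {G : TimeGrid} {t : ℝ≥0} {i : ℕ} :
    i ∈ G.steps t ↔ G.pt (i + 1) ≤ t := by
  simp [TimeGrid.steps]

theorem TimeGrid.steps_mono (G : TimeGrid) {s t : ℝ≥0} (h : s ≤ t) : G.steps s ⊆ G.steps t :=
  fun _ hi => TimeGrid.mem_steps.2 ((TimeGrid.mem_steps.1 hi).trans h)

theorem TimeGrid.steps_zero (G : TimeGrid) : G.steps 0 = ∅ := by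
  ext i
  simp only [TimeGrid.mem_steps, Finset.notMem_empty, iff_false, not_le]
  exact lt_of_le_of_lt (zero_le) (G.strictMono_pt (Nat.lt_succ_self i))

theorem TimeGrid.pt_le_of_mem_steps {G : TimeGrid} {t : ℝ≥0} {i : ℕ} (h : i ∈ G.steps t) :
    G.pt i ≤ t :=
  (G.strictMono_pt (Nat.lt_succ_self i)).le.trans (TimeGrid.mem_steps.1 h)

theorem TimeGrid.exists_steps_eq_range (G : TimeGrid) (t : ℝ≥0) :
    ∃ m, G.steps t = Finset.range m ∧ G.pt m ≤ t ∧ t < G.pt (m + 1) := by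
  classical
  have hex : ∃ m, t < G.pt (m + 1) :=
    (((tendsto_add_atTop_iff_nat 1).2 G.tendsto_pt).eventually_gt_atTop t).exists
  refine ⟨Nat.find hex, ?_, ?_, Nat.find_spec hex⟩
  · ext i
    rw [TimeGrid.mem_steps, Finset.mem_range]
    constructor
    · intro hi
      have := (Nat.find_spec hex).trans_le' hi
      have := G.strictMono_pt.lt_iff_lt.1 this
      omega
    · intro hi
      exact not_lt.1 (Nat.find_min hex hi)
  · rcases Nat.eq_zero_or_pos (Nat.find hex) with h0 | h0
    · rw [h0, G.pt_zero]; exact zero_le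
    · have := not_lt.1 (Nat.find_min hex (Nat.sub_lt h0 one_pos))
      rwa [Nat.sub_add_cancel (show 1 ≤ _ from h0)] at this

/-- Increments of a continuous function telescope to the full increment in the limit. -/
theorem tendsto_sum_increments (T : GridSequence) {S t : ℝ≥0} (ht : t ≤ S) {u : ℝ≥0 → ℝ}
    (hu : ContinuousOn u (Set.Icc 0 S)) :
    Tendsto (fun N => ∑ i ∈ (T.grid N).steps t,
      (u ((T.grid N).pt (i + 1)) - u ((T.grid N).pt i))) atTop (𝓝 (u t - u 0)) := by
  choose m hm hm1 hm2 using fun N => (T.grid N).exists_steps_eq_range t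
  have hsum : ∀ N, ∑ i ∈ (T.grid N).steps t, (u ((T.grid N).pt (i + 1)) - u ((T.grid N).pt i)) =
      u ((T.grid N).pt (m N)) - u 0 := fun N => by
    rw [hm, Finset.sum_range_sub (fun i => u ((T.grid N).pt i)), TimeGrid.pt_zero]
  simp only [hsum]
  refine Tendsto.sub_const ?_ (u 0)
  -- The last grid point not exceeding t is within one mesh width of t.
  have h1 : Tendsto (fun N => (T.grid N).pt (m N)) atTop (𝓝[Set.Icc 0 S] t) := by
    refine tendsto_nhdsWithin_iff.2 ⟨?_, Eventually.of_forall fun N =>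
      ⟨zero_le, (hm1 N).trans ht⟩⟩
    rw [Metric.tendsto_atTop']
    intro ε hε
    obtain ⟨N0, hN0⟩ := eventually_atTop.1 (T.mesh (ε / 2) (half_pos hε))
    refine ⟨N0, fun N hN => ?_⟩
    have h1 := hN0 N hN.le (m N)
    have h2 : ((T.grid N).pt (m N) : ℝ) ≤ t := NNReal.coe_le_coe.2 (hm1 N)
    have h3 : (t : ℝ) < (T.grid N).pt (m N + 1) := NNReal.coe_lt_coe.2 (hm2 N)
    rw [NNReal.dist_eq, abs_lt]
    constructor <;> linarith
  exact (hu t ⟨zero_le, ht⟩).tendsto.comp h1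

/-! ### Weighted sums along the grids and their limits. -/

/-- Replacing `φ (t_i)` by `φ s` in a weighted sum over `(s, t]`. -/
theorem TimeGrid.abs_weightedSum_sub_le (G : TimeGrid) {s t : ℝ≥0} (hst : s ≤ t) {φ : ℝ≥0 → ℝ}
    {ω : ℝ} (h : ∀ i ∈ G.steps t, i ∉ G.steps s → |φ (G.pt i) - φ s| ≤ ω) (w : ℕ → ℝ) :
    |∑ i ∈ G.steps t, φ (G.pt i) * w i - ∑ i ∈ G.steps s, φ (G.pt i) * w i
        - φ s * (∑ i ∈ G.steps t, w i - ∑ i ∈ G.steps s, w i)|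
      ≤ ω * (∑ i ∈ G.steps t, |w i| - ∑ i ∈ G.steps s, |w i|) := by
  have hsub := G.steps_mono hst
  simp only [← Finset.sum_sdiff hsub, add_sub_cancel_right]
  rw [Finset.mul_sum, Finset.mul_sum, ← Finset.sum_sub_distrib]
  refine (Finset.abs_sum_le_sum_abs _ _).trans (Finset.sum_le_sum fun i hi => ?_)
  rw [Finset.mem_sdiff] at hi
  rw [← sub_mul, abs_mul]
  exact mul_le_mul_of_nonneg_right (h i hi.1 hi.2) (abs_nonneg _)

/-- Uniform continuity of φ, with δ chosen before the weights, which will depend on N. Half of the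
modulus serves as window and half as mesh bound, because the first step ending after s may start
before s, by less than one mesh width. -/
theorem exists_eventually_abs_weightedSum_sub_le (T : GridSequence) {S : ℝ≥0} {φ : ℝ≥0 → ℝ}
    (hφ : ContinuousOn φ (Set.Icc 0 S)) {ε : ℝ} (hε : 0 < ε) :
    ∃ δ : ℝ≥0, 0 < δ ∧ ∀ᶠ N in atTop, ∀ (w : ℕ → ℝ) (s t : ℝ≥0), s ≤ t → t ≤ S → t ≤ s + δ →
      |∑ i ∈ (T.grid N).steps t, φ ((T.grid N).pt i) * w i
          - ∑ i ∈ (T.grid N).steps s, φ ((T.grid N).pt i) * w i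
          - φ s * (∑ i ∈ (T.grid N).steps t, w i - ∑ i ∈ (T.grid N).steps s, w i)|
        ≤ ε * (∑ i ∈ (T.grid N).steps t, |w i| - ∑ i ∈ (T.grid N).steps s, |w i|) := by
  obtain ⟨δ, hδ, h⟩ := Metric.uniformContinuousOn_iff.1
    (isCompact_Icc.uniformContinuousOn_of_continuous hφ) ε hε
  refine ⟨⟨δ / 2, (half_pos hδ).le⟩, half_pos hδ, ?_⟩
  filter_upwards [T.mesh (δ / 2) (half_pos hδ)] with N hN w s t hst htS htδ
  refine TimeGrid.abs_weightedSum_sub_le _ hst (fun i hi his => ?_) w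
  have hit := TimeGrid.pt_le_of_mem_steps hi
  rw [TimeGrid.mem_steps, not_le] at his
  have h1 : ((T.grid N).pt i : ℝ) ≤ t := NNReal.coe_le_coe.2 hit
  have h2 : (s : ℝ) < (T.grid N).pt (i + 1) := NNReal.coe_lt_coe.2 his
  have h3 : (t : ℝ) ≤ s + δ / 2 := NNReal.coe_le_coe.2 htδ
  have h4 := hN i
  have := h ((T.grid N).pt i) ⟨zero_le, hit.trans htS⟩ s ⟨zero_le, hst.trans htS⟩
    (by rw [NNReal.dist_eq, abs_lt]; constructor <;> linarith)
  rw [Real.dist_eq] at this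
  exact this.le

/-- Weighted sums are approximated by sums over a fixed partition, uniformly in the weights. -/
theorem exists_partition_approx (T : GridSequence) {S t : ℝ≥0} (ht : t ≤ S) {φ : ℝ≥0 → ℝ}
    (hφ : ContinuousOn φ (Set.Icc 0 S)) {ε : ℝ} (hε : 0 < ε) :
    ∃ (m : ℕ) (s : ℕ → ℝ≥0), (∀ j, s j ≤ t) ∧ ∀ᶠ N in atTop, ∀ w : ℕ → ℝ,
      |∑ i ∈ (T.grid N).steps t, φ ((T.grid N).pt i) * w i
          - ∑ j ∈ Finset.range m, φ (s j) * (∑ i ∈ (T.grid N).steps (s (j + 1)), w i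
              - ∑ i ∈ (T.grid N).steps (s j), w i)|
        ≤ ε * ∑ i ∈ (T.grid N).steps t, |w i| := by
  obtain ⟨δ, hδ, h⟩ := exists_eventually_abs_weightedSum_sub_le T hφ hε
  obtain ⟨m, hm⟩ := exists_nat_ge (t / δ)
  have hm : t ≤ m * δ := by
    have := mul_le_mul_left hm δ
    rwa [div_mul_cancel₀ _ hδ.ne'] at this
  -- Capping the equidistant partition at t makes its last point exactly t, so that the sums over
  -- blocks telescope.
  set s : ℕ → ℝ≥0 := fun j => min (j * δ) t with hs
  have hs0 : s 0 = 0 := by simp [hs]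
  have hsm : s m = t := min_eq_right hm
  refine ⟨m, s, fun j => min_le_right _ _, ?_⟩
  filter_upwards [h] with N hN w
  have e1 : ∑ i ∈ (T.grid N).steps t, φ ((T.grid N).pt i) * w i =
      ∑ j ∈ Finset.range m, (∑ i ∈ (T.grid N).steps (s (j + 1)), φ ((T.grid N).pt i) * w i -
        ∑ i ∈ (T.grid N).steps (s j), φ ((T.grid N).pt i) * w i) := by
    rw [Finset.sum_range_sub (fun j => ∑ i ∈ (T.grid N).steps (s j), φ ((T.grid N).pt i) * w i),
      hsm, hs0, TimeGrid.steps_zero]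
    simp
  have e2 : ∑ i ∈ (T.grid N).steps t, |w i| =
      ∑ j ∈ Finset.range m, (∑ i ∈ (T.grid N).steps (s (j + 1)), |w i| -
        ∑ i ∈ (T.grid N).steps (s j), |w i|) := by
    rw [Finset.sum_range_sub (fun j => ∑ i ∈ (T.grid N).steps (s j), |w i|),
      hsm, hs0, TimeGrid.steps_zero]
    simp
  rw [e1, e2, ← Finset.sum_sub_distrib, Finset.mul_sum]
  refine (Finset.abs_sum_le_sum_abs _ _).trans (Finset.sum_le_sum fun j _ => ?_)
  refine hN w _ _ ?_ ((min_le_right _ _).trans ht) ?_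
  · exact min_le_min_right _ (mul_le_mul_left (by exact_mod_cast Nat.le_succ j) _)
  · simp only [hs]
    rcases le_total ((j : ℝ≥0) * δ) t with hj | hj
    · rw [min_eq_left hj]
      refine (min_le_left _ _).trans ?_
      push_cast
      rw [add_mul, one_mul]
    · rw [min_eq_right hj]
      exact (min_le_right _ _).trans le_self_add

/-- Cauchy criterion: two terms of `a` are compared through `b` and its limit, which costs four
errors of size ε / 5. -/
theorem exists_tendsto_of_forall_approx {a : ℕ → ℝ}
    (h : ∀ ε > 0, ∃ (b : ℕ → ℝ) (l : ℝ), Tendsto b atTop (𝓝 l) ∧ ∀ᶠ N in atTop, |a N - b N| ≤ ε) :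
    ∃ l, Tendsto a atTop (𝓝 l) := by
  refine cauchySeq_tendsto_of_complete (Metric.cauchySeq_iff'.2 fun ε hε => ?_)
  obtain ⟨b, l, hb, hab⟩ := h (ε / 5) (by positivity)
  have hb' := (Metric.tendsto_nhds.1 hb) (ε / 5) (by positivity)
  obtain ⟨N0, hN0⟩ := eventually_atTop.1 (hab.and hb')
  refine ⟨N0, fun n hn => ?_⟩
  obtain ⟨h1, h2⟩ := hN0 n hn
  obtain ⟨h3, h4⟩ := hN0 N0 le_rfl
  rw [Real.dist_eq, abs_lt] at *
  rw [abs_le] at h1 h3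
  constructor <;> linarith

/-- If the weights have uniformly bounded absolute sums and their cumulative sums tend to zero,
then so do the sums weighted by a continuous function. -/
theorem tendsto_weightedSum_zero (T : GridSequence) {S : ℝ≥0} {φ : ℝ≥0 → ℝ}
    (hφ : ContinuousOn φ (Set.Icc 0 S)) {w : ℕ → ℕ → ℝ} {K : ℝ}
    (hK : ∀ᶠ N in atTop, ∑ i ∈ (T.grid N).steps S, |w N i| ≤ K)
    (hw : ∀ t ≤ S, Tendsto (fun N => ∑ i ∈ (T.grid N).steps t, w N i) atTop (𝓝 0))
    {t : ℝ≥0} (ht : t ≤ S) :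
    Tendsto (fun N => ∑ i ∈ (T.grid N).steps t, φ ((T.grid N).pt i) * w N i) atTop (𝓝 0) := by
  rw [Metric.tendsto_nhds]
  intro ε hε
  -- The quantity |K| + 1 bounds the absolute sums and is positive, so it may be divided by. For a
  -- fixed partition only finitely many cumulative sums occur, and each tends to 0.
  obtain ⟨m, s, hs, h⟩ := exists_partition_approx T ht hφ
    (show 0 < ε / 2 / (|K| + 1) by positivity)
  have hb : Tendsto (fun N => ∑ j ∈ Finset.range m, φ (s j) *
      (∑ i ∈ (T.grid N).steps (s (j + 1)), w N i - ∑ i ∈ (T.grid N).steps (s j), w N i))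
      atTop (𝓝 (∑ j ∈ Finset.range m, φ (s j) * (0 - 0))) :=
    tendsto_finsetSum _ fun j _ =>
      ((hw _ ((hs _).trans ht)).sub (hw _ ((hs _).trans ht))).const_mul _
  simp only [sub_zero, mul_zero, Finset.sum_const_zero] at hb
  filter_upwards [h, hK, Metric.tendsto_nhds.1 hb (ε / 2) (half_pos hε)] with N h1 h2 h3
  have h1 := h1 (w N)
  have h4 : ∑ i ∈ (T.grid N).steps t, |w N i| ≤ |K| + 1 :=
    (Finset.sum_le_sum_of_subset_of_nonneg (TimeGrid.steps_mono _ ht)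
      fun _ _ _ => abs_nonneg _).trans (h2.trans ((le_abs_self K).trans (by linarith)))
  have h5 := mul_le_mul_of_nonneg_left h4 (show 0 ≤ ε / 2 / (|K| + 1) by positivity)
  rw [div_mul_cancel₀ _ (by positivity)] at h5
  rw [Real.dist_eq, abs_lt] at *
  have h1 := abs_le.1 (h1.trans h5)
  constructor <;> linarith

/-- If the weights have uniformly bounded absolute sums and their cumulative sums converge to a
continuous function, then the sums weighted by a continuous function converge to a
continuous function. -/
theorem exists_tendsto_weightedSum (T : GridSequence) {S : ℝ≥0} {φ : ℝ≥0 → ℝ}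
    (hφ : ContinuousOn φ (Set.Icc 0 S)) {w : ℕ → ℕ → ℝ} {K : ℝ}
    (hK : ∀ᶠ N in atTop, ∑ i ∈ (T.grid N).steps S, |w N i| ≤ K)
    {W : ℝ≥0 → ℝ} (hWc : Continuous W)
    (hw : ∀ t ≤ S, Tendsto (fun N => ∑ i ∈ (T.grid N).steps t, w N i) atTop (𝓝 (W t))) :
    ∃ J : ℝ≥0 → ℝ, Continuous J ∧ ∀ t ≤ S,
      Tendsto (fun N => ∑ i ∈ (T.grid N).steps t, φ ((T.grid N).pt i) * w N i) atTop
        (𝓝 (J t)) := by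
  have hKt : ∀ t ≤ S, ∀ᶠ N in atTop, ∑ i ∈ (T.grid N).steps t, |w N i| ≤ |K| + 1 := by
    intro t ht
    filter_upwards [hK] with N h2
    exact (Finset.sum_le_sum_of_subset_of_nonneg (TimeGrid.steps_mono _ ht)
      fun _ _ _ => abs_nonneg _).trans (h2.trans ((le_abs_self K).trans (by linarith)))
  -- Stopping at S defines the limit for every t and yields a function continuous on all of `[0,
  -- ∞)`.
  have hex : ∀ t : ℝ≥0, ∃ l, Tendsto (fun N => ∑ i ∈ (T.grid N).steps (min t S),
      φ ((T.grid N).pt i) * w N i) atTop (𝓝 l) := by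
    intro t
    have ht : min t S ≤ S := min_le_right _ _
    generalize min t S = t at ht
    refine exists_tendsto_of_forall_approx fun ε hε => ?_
    obtain ⟨m, s, hs, h⟩ := exists_partition_approx T ht hφ
      (show 0 < ε / (|K| + 1) by positivity)
    refine ⟨_, _, tendsto_finsetSum (Finset.range m) fun j _ =>
      ((hw _ ((hs (j + 1)).trans ht)).sub (hw _ ((hs j).trans ht))).const_mul (φ (s j)), ?_⟩
    filter_upwards [h, hKt t ht] with N h1 h4
    have h5 := mul_le_mul_of_nonneg_left h4 (show 0 ≤ ε / (|K| + 1) by positivity)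
    rw [div_mul_cancel₀ _ (by positivity)] at h5
    exact (h1 (w N)).trans h5
  choose J hJ using hex
  refine ⟨J, ?_, fun t ht => by simpa only [min_eq_left ht] using hJ t⟩
  obtain ⟨M, hM⟩ := isCompact_Icc.exists_bound_of_continuousOn hφ
  have hM0 : 0 ≤ M := (norm_nonneg _).trans (hM 0 ⟨le_rfl, zero_le⟩)
  -- On short intervals the increment of J is φ(s) times that of W up to ε, so J inherits continuity
  -- from W.
  have key : ∀ ε > 0, ∃ δ : ℝ≥0, 0 < δ ∧ ∀ s t : ℝ≥0, s ≤ t → t ≤ s + δ →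
      |J t - J s| ≤ ε + M * |W (min t S) - W (min s S)| := by
    intro ε hε
    obtain ⟨δ, hδ, h⟩ := exists_eventually_abs_weightedSum_sub_le T hφ
      (show 0 < ε / (|K| + 1) by positivity)
    refine ⟨δ, hδ, fun s t hst htδ => ?_⟩
    have hst' : min s S ≤ min t S := min_le_min_right _ hst
    have htS : min t S ≤ S := min_le_right _ _
    have htδ' : min t S ≤ min s S + δ := by
      rcases le_total s S with hs | hs
      · rw [min_eq_left hs]; exact (min_le_left _ _).trans htδ
      · rw [min_eq_right hs]; exact htS.trans le_self_add
    have hlim := (((hJ t).sub (hJ s)).sub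
      (((hw _ htS).sub (hw _ (hst'.trans htS))).const_mul (φ (min s S)))).abs
    have hle : |J t - J s - φ (min s S) * (W (min t S) - W (min s S))| ≤ ε := by
      refine le_of_tendsto hlim ?_
      filter_upwards [h, hKt _ htS] with N h1 h4
      refine (h1 (w N) _ _ hst' htS htδ').trans ?_
      have h6 : 0 ≤ ∑ i ∈ (T.grid N).steps (min s S), |w N i| :=
        Finset.sum_nonneg fun _ _ => abs_nonneg _
      have h5 := mul_le_mul_of_nonneg_left (show ∑ i ∈ (T.grid N).steps (min t S), |w N i| -
        ∑ i ∈ (T.grid N).steps (min s S), |w N i| ≤ |K| + 1 by linarith)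
        (show 0 ≤ ε / (|K| + 1) by positivity)
      rwa [div_mul_cancel₀ _ (by positivity)] at h5
    have h7 : |φ (min s S) * (W (min t S) - W (min s S))| ≤ M * |W (min t S) - W (min s S)| := by
      rw [abs_mul]
      exact mul_le_mul_of_nonneg_right (hM _ ⟨zero_le, min_le_right _ _⟩) (abs_nonneg _)
    have h8 := abs_add_le (J t - J s - φ (min s S) * (W (min t S) - W (min s S)))
      (φ (min s S) * (W (min t S) - W (min s S)))
    rw [sub_add_cancel] at h8
    linarith
  rw [continuous_iff_continuousAt]
  intro t
  rw [ContinuousAt, Metric.tendsto_nhds]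
  intro ε hε
  obtain ⟨δ, hδ, h⟩ := key (ε / 2) (half_pos hε)
  have hWS : Continuous fun s => M * |W (min s S) - W (min t S)| := by fun_prop
  have hW0 := hWS.tendsto t
  simp only [sub_self, abs_zero, mul_zero] at hW0
  filter_upwards [hW0.eventually_lt_const (half_pos hε),
    Metric.ball_mem_nhds t (NNReal.coe_pos.2 hδ)] with s h1 h2
  rw [Metric.mem_ball, NNReal.dist_eq, abs_lt] at h2
  rw [Real.dist_eq]
  rcases le_total s t with hst | hst
  · have := h s t hst (by rw [← NNReal.coe_le_coe]; push_cast; linarith)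
    rw [abs_sub_comm (J s), ]
    rw [abs_sub_comm (W _)] at this
    linarith
  · have := h t s hst (by rw [← NNReal.coe_le_coe]; push_cast; linarith)
    linarith

/-- A pointwise limit of cumulative sums with bounded absolute sums has bounded variation. -/
theorem boundedVariationOn_of_tendsto_sum (T : GridSequence) {S : ℝ≥0} {w : ℕ → ℕ → ℝ} {K : ℝ}
    (hK : ∀ᶠ N in atTop, ∑ i ∈ (T.grid N).steps S, |w N i| ≤ K) {W : ℝ≥0 → ℝ}
    (hw : ∀ t ≤ S, Tendsto (fun N => ∑ i ∈ (T.grid N).steps t, w N i) atTop (𝓝 (W t))) :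
    BoundedVariationOn W (Set.Icc 0 S) := by
  refine ne_top_of_le_ne_top (b := ENNReal.ofReal K) ENNReal.ofReal_ne_top ?_
  refine iSup_le fun p => ?_
  obtain ⟨n, u, hu, hus⟩ := p
  -- For each N the increments over a fixed partition are sums over disjoint blocks of indices, so
  -- their absolute values add up to at most K; then N tends to infinity.
  have h1 : ∑ i ∈ Finset.range n, |W (u (i + 1)) - W (u i)| ≤ K := by
    refine le_of_tendsto (tendsto_finsetSum (Finset.range n) fun i _ =>
      ((hw _ (hus (i + 1)).2).sub (hw _ (hus i).2)).abs) ?_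
    filter_upwards [hK] with N hN
    have h2 : ∀ i ∈ Finset.range n, |∑ j ∈ (T.grid N).steps (u (i + 1)), w N j -
        ∑ j ∈ (T.grid N).steps (u i), w N j| ≤ ∑ j ∈ (T.grid N).steps (u (i + 1)), |w N j| -
        ∑ j ∈ (T.grid N).steps (u i), |w N j| := by
      intro i _
      simp only [← Finset.sum_sdiff ((T.grid N).steps_mono (hu (Nat.le_succ i))),
        add_sub_cancel_right]
      exact Finset.abs_sum_le_sum_abs _ _
    refine (Finset.sum_le_sum h2).trans ?_
    rw [Finset.sum_range_sub (fun i => ∑ j ∈ (T.grid N).steps (u i), |w N j|)]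
    have h3 : 0 ≤ ∑ j ∈ (T.grid N).steps (u 0), |w N j| :=
      Finset.sum_nonneg fun _ _ => abs_nonneg _
    have h4 := Finset.sum_le_sum_of_subset_of_nonneg ((T.grid N).steps_mono (hus n).2)
      (f := fun j => |w N j|) fun _ _ _ => abs_nonneg _
    linarith
  refine le_trans (le_of_eq ?_) (ENNReal.ofReal_le_ofReal h1)
  rw [ENNReal.ofReal_sum_of_nonneg fun _ _ => abs_nonneg _]
  simp [edist_dist, Real.dist_eq]

/-- The increments along a grid are dominated by the variation. -/
theorem TimeGrid.sum_abs_increments_le (G : TimeGrid) {S : ℝ≥0} {u : ℝ≥0 → ℝ}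
    (hu : BoundedVariationOn u (Set.Icc 0 S)) :
    ∑ i ∈ G.steps S, |u (G.pt (i + 1)) - u (G.pt i)| ≤ (eVariationOn u (Set.Icc 0 S)).toReal := by
  obtain ⟨m, hm, hm1, -⟩ := G.exists_steps_eq_range S
  rw [hm, ← ENNReal.ofReal_le_iff_le_toReal hu,
    ENNReal.ofReal_sum_of_nonneg fun _ _ => abs_nonneg _]
  refine le_trans (le_of_eq (Finset.sum_congr rfl fun i _ => ?_))
    (eVariationOn.sum_le_of_monotoneOn_Iic (f := u) (s := Set.Icc 0 S) (u := G.pt) (n := m)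
      (G.strictMono_pt.monotone.monotoneOn _)
      fun i hi => ⟨zero_le, (G.strictMono_pt.monotone hi).trans hm1⟩)
  rw [edist_dist, Real.dist_eq]

/-! ### Calculus of `C^{1,2}` maps. -/

section C12

variable {E F G H E' : Type*} [NormedAddCommGroup E] [NormedSpace ℝ E] [NormedAddCommGroup F]
  [NormedSpace ℝ F] [NormedAddCommGroup G] [NormedSpace ℝ G] [NormedAddCommGroup H]
  [NormedSpace ℝ H] [NormedAddCommGroup E'] [NormedSpace ℝ E']

/-- The class `C^{1,2}` for maps between arbitrary normed spaces. -/
def IsC12Map (f : E → F → G) : Prop :=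
  ContDiff ℝ 1 (Function.uncurry f) ∧
    (∀ a, ContDiff ℝ 2 (f a)) ∧
    Continuous (fun p : E × F => fderiv ℝ (fderiv ℝ (f p.1)) p.2)

/-- With the derivatives as explicit witnesses, stability under sums and composition reduces to the
rules of `HasFDerivAt` and continuity of the second derivative. -/
theorem isC12Map_iff_exists {f : E → F → G} :
    IsC12Map f ↔ ContDiff ℝ 1 (Function.uncurry f) ∧
      ∃ (f' : E → F → F →L[ℝ] G) (f'' : E → F → F →L[ℝ] F →L[ℝ] G),
        (∀ a x, HasFDerivAt (f a) (f' a x) x) ∧ (∀ a x, HasFDerivAt (f' a) (f'' a x) x) ∧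
        Continuous (Function.uncurry f'') := by
  constructor
  · rintro ⟨h1, h2, h3⟩
    refine ⟨h1, fun a => fderiv ℝ (f a), fun a => fderiv ℝ (fderiv ℝ (f a)), fun a x => ?_,
      fun a x => ?_, h3⟩
    · exact ((h2 a).differentiable (by norm_num) x).hasFDerivAt
    · exact (((h2 a).fderiv_right (m := 1) (by norm_num)).differentiable one_ne_zero x).hasFDerivAt
  · rintro ⟨h1, f', f'', hf', hf'', hc⟩
    have e' : ∀ a, fderiv ℝ (f a) = f' a := fun a => funext fun x => (hf' a x).fderiv
    refine ⟨h1, fun a => ?_, ?_⟩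
    · rw [show (2 : WithTop ℕ∞) = 1 + 1 by norm_num]
      refine (contDiff_succ_iff_hasFDerivAt (n := 1)).2 ⟨f' a, ?_, hf' a⟩
      exact contDiff_one_iff_hasFDerivAt.2 ⟨f'' a,
        hc.comp (f := fun x => (a, x)) (by fun_prop), hf'' a⟩
    · simp only [e', (hf'' _ _).fderiv]
      exact hc

namespace IsC12Map

variable {f : E → F → G}

theorem hasFDerivAt_left (hf : IsC12Map f) (a : E) (x : F) :
    HasFDerivAt (fun a => f a x)
      ((fderiv ℝ (Function.uncurry f) (a, x)).comp (ContinuousLinearMap.inl ℝ E F)) a :=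
  ((hf.1.differentiable one_ne_zero (a, x)).hasFDerivAt).comp (f := fun a => (a, x)) a
    (hasFDerivAt_prodMk_left a x)

theorem hasFDerivAt_right (hf : IsC12Map f) (a : E) (x : F) :
    HasFDerivAt (f a)
      ((fderiv ℝ (Function.uncurry f) (a, x)).comp (ContinuousLinearMap.inr ℝ E F)) x :=
  ((hf.1.differentiable one_ne_zero (a, x)).hasFDerivAt).comp (f := fun x => (a, x)) x
    (hasFDerivAt_prodMk_right a x)

theorem continuous_fderiv_uncurry (hf : IsC12Map f) : Continuous (fderiv ℝ (Function.uncurry f)) :=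
  hf.1.continuous_fderiv one_ne_zero

theorem continuous_fderiv_left (hf : IsC12Map f) :
    Continuous fun p : E × F => fderiv ℝ (fun a => f a p.2) p.1 := by
  simp only [(hf.hasFDerivAt_left _ _).fderiv]
  exact hf.continuous_fderiv_uncurry.clm_comp continuous_const

theorem continuous_fderiv_right (hf : IsC12Map f) :
    Continuous fun p : E × F => fderiv ℝ (f p.1) p.2 := by
  simp only [(hf.hasFDerivAt_right _ _).fderiv]
  exact hf.continuous_fderiv_uncurry.clm_comp continuous_const

theorem differentiable_fderiv (hf : IsC12Map f) (a : E) : Differentiable ℝ (fderiv ℝ (f a)) :=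
  ((hf.2.1 a).fderiv_right (m := 1) (by norm_num)).differentiable one_ne_zero

/-- Reparametrization by a continuous linear map. -/
theorem comp_left (hf : IsC12Map f) (L : E' →L[ℝ] E) : IsC12Map fun a => f (L a) :=
  ⟨hf.1.comp (f := fun p : E' × F => (L p.1, p.2)) (by fun_prop), fun a => hf.2.1 (L a),
    hf.2.2.comp (f := fun p : E' × F => (L p.1, p.2)) (by fun_prop)⟩

theorem of_left (L : E →L[ℝ] G) : IsC12Map fun (a : E) (_ : F) => L a :=
  isC12Map_iff_exists.2 ⟨by unfold Function.uncurry; fun_prop, fun _ _ => 0, fun _ _ => 0,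
    fun a x => hasFDerivAt_const _ _, fun a x => hasFDerivAt_const _ _, continuous_const⟩

theorem add {g : E → F → G} (hf : IsC12Map f) (hg : IsC12Map g) :
    IsC12Map fun a x => f a x + g a x := by
  obtain ⟨h1, f', f'', hf1, hf2, hf3⟩ := isC12Map_iff_exists.1 hf
  obtain ⟨k1, g', g'', hg1, hg2, hg3⟩ := isC12Map_iff_exists.1 hg
  exact isC12Map_iff_exists.2 ⟨h1.add k1, fun a x => f' a x + g' a x,
    fun a x => f'' a x + g'' a x, fun a x => (hf1 a x).add (hg1 a x),
    fun a x => (hf2 a x).add (hg2 a x), hf3.add hg3⟩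

theorem sum {ι : Type*} (s : Finset ι) {f : ι → E → F → G} (hf : ∀ i ∈ s, IsC12Map (f i)) :
    IsC12Map fun a x => ∑ i ∈ s, f i a x := by
  classical
  induction s using Finset.induction_on with
  | empty => simpa using of_left (F := F) (0 : E →L[ℝ] G)
  | insert i s hi ih =>
    simp only [Finset.sum_insert hi]
    exact (hf i (Finset.mem_insert_self i s)).add
      (ih fun j hj => hf j (Finset.mem_insert_of_mem hj))

/-- Composition of a `C^{1,2}` map with a `C^{1,2}` map in the second variable. -/
theorem comp {g : E → G → H} (hg : IsC12Map g) (hf : IsC12Map f) :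
    IsC12Map fun a x => g a (f a x) := by
  obtain ⟨h1, f', f'', hf1, hf2, hf3⟩ := isC12Map_iff_exists.1 hf
  obtain ⟨k1, g', g'', hg1, hg2, hg3⟩ := isC12Map_iff_exists.1 hg
  have hc : Continuous fun p : E × F => (p.1, f p.1 p.2) := continuous_fst.prodMk h1.continuous
  have hf' : Continuous fun p : E × F => f' p.1 p.2 := by
    simpa only [(hf1 _ _).fderiv] using hf.continuous_fderiv_right
  have hg' : Continuous fun p : E × F => g' p.1 (f p.1 p.2) := by
    have : Continuous fun p : E × G => g' p.1 p.2 := by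
      simpa only [(hg1 _ _).fderiv] using hg.continuous_fderiv_right
    exact this.comp hc
  have hg'' : Continuous fun p : E × F => g'' p.1 (f p.1 p.2) := hg3.comp hc
  refine isC12Map_iff_exists.2 ⟨k1.comp (contDiff_fst.prodMk h1),
    fun a x => (g' a (f a x)).comp (f' a x), _, fun a x => (hg1 a _).comp x (hf1 a x),
    fun a x => HasFDerivAt.clm_comp ((hg2 a _).comp x (hf1 a x)) (hf2 a x), ?_⟩
  -- The two terms of the second derivative: g' composed with f'', and g'' evaluated on f' in both
  -- arguments.
  exact (((ContinuousLinearMap.compL ℝ F G H).continuous.comp hg').clm_comp hf3).add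
    (((ContinuousLinearMap.compL ℝ F G H).flip.continuous.comp hf').clm_comp (hg''.clm_comp hf'))

/-- The second order Taylor estimate for `C^{1,2}` functions, uniformly on balls. -/
theorem exists_taylor_bound [ProperSpace E] [ProperSpace F] {f : E → F → ℝ} (hf : IsC12Map f)
    (R : ℝ) {ε : ℝ} (hε : 0 < ε) :
    ∃ δ > 0, ∀ a a' x x', ‖a‖ ≤ R → ‖a'‖ ≤ R → ‖x‖ ≤ R → ‖x'‖ ≤ R → ‖a' - a‖ ≤ δ →
      ‖x' - x‖ ≤ δ →
      |f a' x' - f a x - fderiv ℝ (f a) x (x' - x) - fderiv ℝ (fun a => f a x) a (a' - a)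
        - 1 / 2 * fderiv ℝ (fderiv ℝ (f a)) x (x' - x) (x' - x)|
      ≤ ε * (‖a' - a‖ + ‖x' - x‖ ^ 2) := by
  have hK : IsCompact (Metric.closedBall (0 : E × F) R) := isCompact_closedBall _ _
  obtain ⟨δ₁, hδ₁, h₁⟩ := Metric.uniformContinuousOn_iff_le.1
    (hK.uniformContinuousOn_of_continuous hf.continuous_fderiv_left.continuousOn) ε hε
  obtain ⟨δ₂, hδ₂, h₂⟩ := (Metric.uniformContinuousOn_iff_le (β := F →L[ℝ] F →L[ℝ] ℝ)
    (f := fun p : E × F => fderiv ℝ (fderiv ℝ (f p.1)) p.2)).1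
    (hK.uniformContinuousOn_of_continuous (Continuous.continuousOn hf.2.2)) ε hε
  refine ⟨min δ₁ δ₂, lt_min hδ₁ hδ₂, fun a a' x x' ha ha' hx hx' hda hdx => ?_⟩
  have hmem : ∀ {b : E} {y : F}, ‖b‖ ≤ R → ‖y‖ ≤ R → (b, y) ∈ Metric.closedBall (0 : E × F) R :=
    fun hb hy => by
      rw [mem_closedBall_zero_iff, Prod.norm_def]
      exact max_le hb hy
  -- Mean value inequality in the parameter with x' held fixed. Replacing the derivative at (a, x')
  -- by the one at (a, x) is covered by uniform continuity, so no mixed derivative is needed.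
  have hA : |f a' x' - f a x' - fderiv ℝ (fun a => f a x) a (a' - a)| ≤ ε * ‖a' - a‖ := by
    have hconv : Convex ℝ (Metric.closedBall (0 : E) R ∩ Metric.closedBall a ‖a' - a‖) :=
      (convex_closedBall _ _).inter (convex_closedBall _ _)
    have := hconv.norm_image_sub_le_of_norm_hasFDerivWithin_le (C := ε)
      (f := fun b => f b x' - fderiv ℝ (fun a => f a x) a b)
      (f' := fun b => fderiv ℝ (fun a => f a x') b - fderiv ℝ (fun a => f a x) a)
      (x := a) (y := a') (fun b _ => ((hf.hasFDerivAt_left b x').differentiableAt.hasFDerivAt.sub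
        (ContinuousLinearMap.hasFDerivAt _)).hasFDerivWithinAt) (fun b hb => ?_)
      ⟨by simpa using ha, by simp⟩ ⟨by simpa using ha', by simp [dist_eq_norm]⟩
    · rw [map_sub]
      rw [Real.norm_eq_abs] at this
      convert this using 2
      ring
    · rw [← dist_eq_norm]
      have hb1 := mem_closedBall_zero_iff.1 hb.1
      have hb2 := Metric.mem_closedBall.1 hb.2
      refine h₁ (b, x') (hmem hb1 hx') (a, x) (hmem ha hx) ?_
      rw [Prod.dist_eq]
      exact max_le (hb2.trans (hda.trans (min_le_left _ _)))
        ((dist_eq_norm x' x).trans_le (hdx.trans (min_le_left _ _)))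
  set D := fderiv ℝ (f a) with hD
  set Q := fderiv ℝ D x with hQ
  have hconv : Convex ℝ (Metric.closedBall (0 : F) R ∩ Metric.closedBall x ‖x' - x‖) :=
    (convex_closedBall _ _).inter (convex_closedBall _ _)
  have hxm : x ∈ Metric.closedBall (0 : F) R ∩ Metric.closedBall x ‖x' - x‖ :=
    ⟨by simpa using hx, by simp⟩
  have hxm' : x' ∈ Metric.closedBall (0 : F) R ∩ Metric.closedBall x ‖x' - x‖ :=
    ⟨by simpa using hx', by simp [dist_eq_norm]⟩
  -- Symmetry makes the derivative of 1/2 Q(y - x)(y - x) equal to Q(y - x).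
  have hsymm : ∀ v w, Q v w = Q w v := by
    have := ((hf.2.1 a).contDiffAt (x := x)).isSymmSndFDerivAt (by simp)
    exact fun v w => this v w
  have hD' : ∀ y ∈ Metric.closedBall (0 : F) R ∩ Metric.closedBall x ‖x' - x‖,
      ‖D y - D x - Q (y - x)‖ ≤ ε * ‖x' - x‖ := by
    intro y hy
    have := hconv.norm_image_sub_le_of_norm_hasFDerivWithin_le (C := ε)
      (f := fun y => D y - Q y) (f' := fun y => fderiv ℝ D y - Q) (x := x) (y := y)
      (fun b _ => ((hf.differentiable_fderiv a b).hasFDerivAt.sub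
        (ContinuousLinearMap.hasFDerivAt _)).hasFDerivWithinAt) (fun b hb => ?_) hxm hy
    · have hyx : ‖y - x‖ ≤ ‖x' - x‖ := by simpa [dist_eq_norm] using hy.2
      refine le_trans (le_of_eq ?_) (this.trans (mul_le_mul_of_nonneg_left hyx hε.le))
      rw [map_sub]
      congr 1
      abel
    · rw [← dist_eq_norm]
      have hb1 := mem_closedBall_zero_iff.1 hb.1
      have hb2 := Metric.mem_closedBall.1 hb.2
      refine h₂ (a, b) (hmem ha hb1) (a, x) (hmem ha hx) ?_
      rw [Prod.dist_eq, dist_self]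
      exact max_le hδ₂.le (hb2.trans (hdx.trans (min_le_right _ _)))
  -- A second application of the mean value inequality: the function minus its quadratic Taylor
  -- polynomial has the derivative estimated in `hD'`.
  have hB : |f a x' - f a x - D x (x' - x) - 1 / 2 * Q (x' - x) (x' - x)| ≤
      ε * ‖x' - x‖ ^ 2 := by
    have := hconv.norm_image_sub_le_of_norm_hasFDerivWithin_le (C := ε * ‖x' - x‖)
      (f := fun y => f a y - D x y - 1 / 2 * Q (y - x) (y - x))
      (f' := fun y => D y - D x - Q (y - x)) (x := x) (y := x') (fun y _ => ?_) hD' hxm hxm'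
    · rw [Real.norm_eq_abs] at this
      rw [pow_two, ← mul_assoc]
      convert this using 2
      simp only [map_sub, sub_self, map_zero, sub_apply, mul_zero]
      ring
    · refine HasFDerivAt.hasFDerivWithinAt ?_
      have h1 : HasFDerivAt (fun y => y - x) (ContinuousLinearMap.id ℝ F) y :=
        (hasFDerivAt_id y).sub_const x
      have h2 := ((Q.hasFDerivAt.comp y h1).clm_apply h1).const_mul (1 / 2)
      have h3 := ((hf.hasFDerivAt_right a y).differentiableAt.hasFDerivAt.sub
        (D x).hasFDerivAt).sub h2
      refine h3.congr_fderiv ?_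
      ext v
      simp only [sub_apply, smul_apply,
        add_apply, ContinuousLinearMap.comp_apply,
        ContinuousLinearMap.flip_apply, ContinuousLinearMap.id_apply, Function.comp_apply,
        smul_eq_mul, hsymm v]
      simp only [← hD]
      ring
  rw [abs_le] at *
  rw [mul_add]
  constructor <;> linarith

end IsC12Map

end C12

/-! ### The pathwise Itô formula. -/

theorem sum_apply_mul_single {n : ℕ} (L : EuclideanSpace ℝ (Fin n) →L[ℝ] ℝ)
    (v : EuclideanSpace ℝ (Fin n)) :
    L v = ∑ k, L (EuclideanSpace.single k 1) * v k := by
  conv_lhs => rw [← (EuclideanSpace.basisFun (Fin n) ℝ).sum_repr v]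
  simp [mul_comm]

theorem norm_le_sum_abs {n : ℕ} (v : EuclideanSpace ℝ (Fin n)) : ‖v‖ ≤ ∑ k, |v k| := by
  conv_lhs => rw [← (EuclideanSpace.basisFun (Fin n) ℝ).sum_repr v]
  refine (norm_sum_le _ _).trans (le_of_eq ?_)
  simp [norm_smul]

theorem eventually_dist_increment_le (T : GridSequence) {S : ℝ≥0} {M : Type*}
    [PseudoMetricSpace M] {u : ℝ≥0 → M} (hu : ContinuousOn u (Set.Icc 0 S)) {δ : ℝ} (hδ : 0 < δ) :
    ∀ᶠ N in atTop, ∀ i ∈ (T.grid N).steps S,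
      dist (u ((T.grid N).pt (i + 1))) (u ((T.grid N).pt i)) ≤ δ := by
  obtain ⟨ρ, hρ, h⟩ := Metric.uniformContinuousOn_iff_le.1
    (isCompact_Icc.uniformContinuousOn_of_continuous hu) δ hδ
  filter_upwards [T.mesh ρ hρ] with N hN i hi
  refine h _ ⟨zero_le, TimeGrid.mem_steps.1 hi⟩ _ ⟨zero_le, TimeGrid.pt_le_of_mem_steps hi⟩ ?_
  rw [NNReal.dist_eq, abs_of_nonneg (sub_nonneg.2 (NNReal.coe_le_coe.2
    ((T.grid N).strictMono_pt (Nat.lt_succ_self i)).le))]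
  exact hN i

section Ito

variable {T : GridSequence} {d n : ℕ} {X : ℝ≥0 → EuclideanSpace ℝ (Fin d)}
  {A : ℝ≥0 → EuclideanSpace ℝ (Fin n)} {S : ℝ≥0}

/-- The first variation of `A` plus the quadratic variation of `X` along the grids is bounded. -/
theorem exists_bound_sum_norm_add_sq (hX : IsIntegrator T X)
    (hA : ∀ k, BoundedVariationOn (fun t => A t k) (Set.Icc 0 S)) :
    ∃ K, 0 ≤ K ∧ ∀ᶠ N in atTop, ∑ i ∈ (T.grid N).steps S,
      (‖A ((T.grid N).pt (i + 1)) - A ((T.grid N).pt i)‖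
        + ‖X ((T.grid N).pt (i + 1)) - X ((T.grid N).pt i)‖ ^ 2) ≤ K := by
  choose C _ hC using fun k => hX.2 k k
  -- The convergent sums for [X^k, X^k] eventually lie below their limit plus 1.
  have hlim := (tendsto_finsetSum Finset.univ fun k _ => hC k S).eventually_le_const
    (lt_add_one (∑ k, C k S))
  refine ⟨|∑ k, (eVariationOn (fun t => A t k) (Set.Icc 0 S)).toReal + (∑ k, C k S + 1)|,
    abs_nonneg _, ?_⟩
  filter_upwards [hlim] with N hN
  refine le_trans ?_ (le_abs_self _)
  rw [Finset.sum_add_distrib]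
  refine add_le_add ?_ ?_
  · refine (Finset.sum_le_sum fun i _ => norm_le_sum_abs _).trans ?_
    rw [Finset.sum_comm]
    exact Finset.sum_le_sum fun k _ => (T.grid N).sum_abs_increments_le (hA k)
  · refine le_trans (le_of_eq ?_) hN
    simp only [covariationSum]
    rw [Finset.sum_comm]
    refine Finset.sum_congr rfl fun i _ => ?_
    rw [EuclideanSpace.real_norm_sq_eq]
    exact Finset.sum_congr rfl fun k _ => pow_two _

/-- The Taylor estimate along the grids. -/
theorem eventually_abs_taylor_remainder_le (hX : Continuous X) (hA : Continuous A)
    {f : EuclideanSpace ℝ (Fin n) → EuclideanSpace ℝ (Fin d) → ℝ} (hf : IsC12Map f)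
    {ε : ℝ} (hε : 0 < ε) :
    ∀ᶠ N in atTop, ∀ i ∈ (T.grid N).steps S, ∀ a a' x x', a = A ((T.grid N).pt i) →
      a' = A ((T.grid N).pt (i + 1)) → x = X ((T.grid N).pt i) → x' = X ((T.grid N).pt (i + 1)) →
      |f a' x' - f a x - fderiv ℝ (f a) x (x' - x) - fderiv ℝ (fun a => f a x) a (a' - a)
        - 1 / 2 * fderiv ℝ (fderiv ℝ (f a)) x (x' - x) (x' - x)|
      ≤ ε * (‖a' - a‖ + ‖x' - x‖ ^ 2) := by
  obtain ⟨R₁, hR₁⟩ := (isCompact_Icc (a := 0) (b := S)).exists_bound_of_continuousOn hX.continuousOn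
  obtain ⟨R₂, hR₂⟩ := (isCompact_Icc (a := 0) (b := S)).exists_bound_of_continuousOn hA.continuousOn
  obtain ⟨δ, hδ, h⟩ := hf.exists_taylor_bound (max R₁ R₂) hε
  filter_upwards [eventually_dist_increment_le T (S := S) hX.continuousOn hδ,
    eventually_dist_increment_le T (S := S) hA.continuousOn hδ] with N h1 h2 i hi
  rintro a a' x x' rfl rfl rfl rfl
  have hi0 : (T.grid N).pt i ∈ Set.Icc 0 S := ⟨zero_le, TimeGrid.pt_le_of_mem_steps hi⟩
  have hi1 : (T.grid N).pt (i + 1) ∈ Set.Icc 0 S := ⟨zero_le, TimeGrid.mem_steps.1 hi⟩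
  exact h _ _ _ _ ((hR₂ _ hi0).trans (le_max_right _ _)) ((hR₂ _ hi1).trans (le_max_right _ _))
    ((hR₁ _ hi0).trans (le_max_left _ _)) ((hR₁ _ hi1).trans (le_max_left _ _))
    ((dist_eq_norm _ _).symm.trans_le (h2 i hi)) ((dist_eq_norm _ _).symm.trans_le (h1 i hi))

/-- The compensator in the pathwise Itô formula: the increments of `f (A, X)` minus those of the
Itô integral sum up to a continuous function of bounded variation. -/
theorem exists_compensator (hX : IsIntegrator T X) (hA : Continuous A)
    (hAv : ∀ k, BoundedVariationOn (fun t => A t k) (Set.Icc 0 S))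
    {f : EuclideanSpace ℝ (Fin n) → EuclideanSpace ℝ (Fin d) → ℝ} (hf : IsC12Map f)
    {w : ℕ → ℕ → ℝ}
    (hw : ∀ N i, w N i = f (A ((T.grid N).pt (i + 1))) (X ((T.grid N).pt (i + 1)))
      - f (A ((T.grid N).pt i)) (X ((T.grid N).pt i))
      - fderiv ℝ (f (A ((T.grid N).pt i))) (X ((T.grid N).pt i))
          (X ((T.grid N).pt (i + 1)) - X ((T.grid N).pt i))) :
    (∃ K, ∀ᶠ N in atTop, ∑ i ∈ (T.grid N).steps S, |w N i| ≤ K) ∧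
    ∃ J : ℝ≥0 → ℝ, Continuous J ∧
      ∀ t ≤ S, Tendsto (fun N => ∑ i ∈ (T.grid N).steps t, w N i) atTop (𝓝 (J t)) := by
  obtain ⟨K, hK0, hK⟩ := exists_bound_sum_norm_add_sq (S := S) hX hAv
  have hAX : Continuous fun s => (A s, X s) := hA.prodMk hX.1
  have hD1 : Continuous fun s => fderiv ℝ (fun a => f a (X s)) (A s) :=
    hf.continuous_fderiv_left.comp hAX
  have hD2 : Continuous fun s => fderiv ℝ (fderiv ℝ (f (A s))) (X s) := hf.2.2.comp hAX
  set D1 : ℝ≥0 → EuclideanSpace ℝ (Fin n) →L[ℝ] ℝ := fun s => fderiv ℝ (fun a => f a (X s)) (A s)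
    with hD1_def
  set D2 : ℝ≥0 → EuclideanSpace ℝ (Fin d) →L[ℝ] EuclideanSpace ℝ (Fin d) →L[ℝ] ℝ :=
    fun s => fderiv ℝ (fderiv ℝ (f (A s))) (X s) with hD2_def
  set dA : ℕ → ℕ → EuclideanSpace ℝ (Fin n) := fun N i =>
    A ((T.grid N).pt (i + 1)) - A ((T.grid N).pt i) with hdA
  set dX : ℕ → ℕ → EuclideanSpace ℝ (Fin d) := fun N i =>
    X ((T.grid N).pt (i + 1)) - X ((T.grid N).pt i) with hdX
  -- The Taylor remainder: w splits into a first-order term in ΔA, a second-order term in ΔX, and r,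
  -- which is small relative to |ΔA| + |ΔX|².
  set r : ℕ → ℕ → ℝ := fun N i => w N i - D1 ((T.grid N).pt i) (dA N i)
    - 1 / 2 * D2 ((T.grid N).pt i) (dX N i) (dX N i) with hr_def
  have hr : ∀ ε > 0, ∀ᶠ N in atTop, ∀ i ∈ (T.grid N).steps S,
      |r N i| ≤ ε * (‖dA N i‖ + ‖dX N i‖ ^ 2) := by
    intro ε hε
    filter_upwards [eventually_abs_taylor_remainder_le (T := T) (S := S) hX.1 hA hf hε]
      with N hN i hi
    have := hN i hi _ _ _ _ rfl rfl rfl rfl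
    simpa only [hr_def, hw] using this
  refine ⟨?_, ?_⟩
  · obtain ⟨M1, hM1⟩ := (isCompact_Icc (a := 0) (b := S)).exists_bound_of_continuousOn
      hD1.continuousOn
    obtain ⟨M2, hM2⟩ := (isCompact_Icc (a := 0) (b := S)).exists_bound_of_continuousOn (f := D2)
      (Continuous.continuousOn hD2)
    refine ⟨(|M1| + |M2| + 1) * K, ?_⟩
    filter_upwards [hK, hr 1 one_pos] with N h1 h2
    refine le_trans ?_ (mul_le_mul_of_nonneg_left h1 (by positivity))
    rw [Finset.mul_sum]
    refine Finset.sum_le_sum fun i hi => ?_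
    have hi0 : (T.grid N).pt i ∈ Set.Icc 0 S := ⟨zero_le, TimeGrid.pt_le_of_mem_steps hi⟩
    have e1 : |D1 ((T.grid N).pt i) (dA N i)| ≤ |M1| * ‖dA N i‖ :=
      ((D1 _).le_opNorm _).trans (mul_le_mul_of_nonneg_right
        ((hM1 _ hi0).trans (le_abs_self _)) (norm_nonneg _))
    have e2 : |D2 ((T.grid N).pt i) (dX N i) (dX N i)| ≤ |M2| * ‖dX N i‖ ^ 2 := by
      refine ((D2 _).le_opNorm₂ _ _).trans ?_
      rw [mul_assoc, ← pow_two]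
      exact mul_le_mul_of_nonneg_right ((hM2 _ hi0).trans (le_abs_self _)) (by positivity)
    have e3 := h2 i hi
    have e4 : w N i = r N i + D1 ((T.grid N).pt i) (dA N i)
      + 1 / 2 * D2 ((T.grid N).pt i) (dX N i) (dX N i) := by rw [hr_def]; ring
    have n1 := norm_nonneg (dA N i)
    have n2 : 0 ≤ ‖dX N i‖ ^ 2 := by positivity
    have p1 := mul_nonneg (abs_nonneg M1) n2
    have p2 := mul_nonneg (abs_nonneg M2) n1
    have p3 := mul_nonneg (abs_nonneg M2) n2
    rw [e4]
    change _ ≤ (|M1| + |M2| + 1) * (‖dA N i‖ + ‖dX N i‖ ^ 2)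
    rw [abs_le] at *
    constructor <;> nlinarith
  -- A Stieltjes integral against A^k: the weights ΔA^k have absolute sums bounded by the variation.
  have h1 : ∀ k, ∃ J : ℝ≥0 → ℝ, Continuous J ∧ ∀ t ≤ S,
      Tendsto (fun N => ∑ i ∈ (T.grid N).steps t,
        D1 ((T.grid N).pt i) (EuclideanSpace.single k 1) * dA N i k) atTop (𝓝 (J t)) := by
    intro k
    refine exists_tendsto_weightedSum T (φ := fun s => D1 s (EuclideanSpace.single k 1))
      (Continuous.continuousOn (by fun_prop)) (w := fun N i => dA N i k)
      (Eventually.of_forall fun N => (T.grid N).sum_abs_increments_le (hAv k))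
      (W := fun t => A t k - A 0 k) (by fun_prop) fun t ht => ?_
    exact tendsto_sum_increments T ht (u := fun t => A t k) (Continuous.continuousOn (by fun_prop))
  -- An integral against [X^k, X^m], whose weights are dominated by |ΔX|².
  have h2 : ∀ k m, ∃ J : ℝ≥0 → ℝ, Continuous J ∧ ∀ t ≤ S,
      Tendsto (fun N => ∑ i ∈ (T.grid N).steps t,
        (1 / 2 * D2 ((T.grid N).pt i) (EuclideanSpace.single k 1) (EuclideanSpace.single m 1))
          * (dX N i k * dX N i m)) atTop (𝓝 (J t)) := by
    intro k m
    obtain ⟨C, hCc, hC⟩ := hX.2 k m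
    refine exists_tendsto_weightedSum T
      (φ := fun s => 1 / 2 * D2 s (EuclideanSpace.single k 1) (EuclideanSpace.single m 1))
      (Continuous.continuousOn (by fun_prop)) (w := fun N i => dX N i k * dX N i m) (K := K)
      ?_ hCc fun t _ => hC t
    filter_upwards [hK] with N hN
    refine (Finset.sum_le_sum fun i _ => ?_).trans hN
    rw [abs_mul]
    have q1 : |dX N i k| ≤ ‖dX N i‖ := PiLp.norm_apply_le (dX N i) k
    have q2 : |dX N i m| ≤ ‖dX N i‖ := PiLp.norm_apply_le (dX N i) m
    have := mul_le_mul q1 q2 (abs_nonneg _) (norm_nonneg _)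
    rw [← pow_two] at this
    exact this.trans (le_add_of_nonneg_left (norm_nonneg _))
  choose J1 hJ1c hJ1 using h1
  choose J2 hJ2c hJ2 using h2
  refine ⟨fun t => ∑ k, J1 k t + ∑ k, ∑ m, J2 k m t, by fun_prop, fun t ht => ?_⟩
  have h3 : Tendsto (fun N => ∑ i ∈ (T.grid N).steps t, r N i) atTop (𝓝 0) := by
    rw [Metric.tendsto_nhds]
    intro ε hε
    filter_upwards [hr (ε / (K + 1)) (by positivity), hK] with N q1 q2
    rw [Real.dist_eq, sub_zero]
    calc |∑ i ∈ (T.grid N).steps t, r N i| ≤ ∑ i ∈ (T.grid N).steps t, |r N i| :=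
          Finset.abs_sum_le_sum_abs _ _
      _ ≤ ∑ i ∈ (T.grid N).steps S, |r N i| :=
          Finset.sum_le_sum_of_subset_of_nonneg (TimeGrid.steps_mono _ ht)
            fun _ _ _ => abs_nonneg _
      _ ≤ ∑ i ∈ (T.grid N).steps S, ε / (K + 1) * (‖dA N i‖ + ‖dX N i‖ ^ 2) :=
          Finset.sum_le_sum q1
      _ ≤ ε / (K + 1) * K := by
          rw [← Finset.mul_sum]
          exact mul_le_mul_of_nonneg_left q2 (by positivity)
      _ < ε := by
          rw [div_mul_eq_mul_div, div_lt_iff₀ (by positivity)]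
          linarith
  have h4 := ((tendsto_finsetSum Finset.univ fun k _ => hJ1 k t ht).add
    (tendsto_finsetSum Finset.univ fun k _ => tendsto_finsetSum Finset.univ
      fun m _ => hJ2 k m t ht)).add h3
  rw [add_zero] at h4
  refine h4.congr fun N => ?_
  have c1 : ∑ k, ∑ i ∈ (T.grid N).steps t,
      D1 ((T.grid N).pt i) (EuclideanSpace.single k 1) * dA N i k =
      ∑ i ∈ (T.grid N).steps t, D1 ((T.grid N).pt i) (dA N i) := by
    rw [Finset.sum_comm]
    exact Finset.sum_congr rfl fun i _ => (sum_apply_mul_single _ _).symm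
  have c2 : ∑ k, ∑ m, ∑ i ∈ (T.grid N).steps t,
      (1 / 2 * D2 ((T.grid N).pt i) (EuclideanSpace.single k 1) (EuclideanSpace.single m 1))
          * (dX N i k * dX N i m) =
      ∑ i ∈ (T.grid N).steps t, 1 / 2 * D2 ((T.grid N).pt i) (dX N i) (dX N i) := by
    have : ∀ k, ∑ m, ∑ i ∈ (T.grid N).steps t,
      (1 / 2 * D2 ((T.grid N).pt i) (EuclideanSpace.single k 1) (EuclideanSpace.single m 1))
          * (dX N i k * dX N i m) = ∑ i ∈ (T.grid N).steps t,
      1 / 2 * (D2 ((T.grid N).pt i) (EuclideanSpace.single k 1) (dX N i) * dX N i k) := by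
      intro k
      rw [Finset.sum_comm]
      refine Finset.sum_congr rfl fun i _ => ?_
      rw [sum_apply_mul_single (D2 ((T.grid N).pt i) (EuclideanSpace.single k 1)) (dX N i),
        Finset.sum_mul, Finset.mul_sum]
      exact Finset.sum_congr rfl fun m _ => by ring
    simp only [this]
    rw [Finset.sum_comm]
    refine Finset.sum_congr rfl fun i _ => ?_
    have := sum_apply_mul_single ((D2 ((T.grid N).pt i)).flip (dX N i)) (dX N i)
    simp only [ContinuousLinearMap.flip_apply] at this
    rw [this, Finset.mul_sum]
  rw [c1, c2, ← Finset.sum_add_distrib, ← Finset.sum_add_distrib]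
  refine Finset.sum_congr rfl fun i _ => ?_
  simp only [hr_def]
  ring

/-- The pathwise Itô formula for an integrand `∇ₓ f (A, X)`: its integral is `f (A, X) - B` with
`B` continuous and of bounded variation. -/
theorem exists_ito_decomposition (hX : IsIntegrator T X) (hA : Continuous A)
    (hAv : ∀ k, BoundedVariationOn (fun t => A t k) (Set.Icc 0 S))
    {f : EuclideanSpace ℝ (Fin n) → EuclideanSpace ℝ (Fin d) → ℝ} (hf : IsC12Map f)
    {ξ : ℝ≥0 → EuclideanSpace ℝ (Fin d)} (hξ : ∀ t ≤ S, ξ t = gradient (f (A t)) (X t)) :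
    ∃ B : ℝ≥0 → ℝ, Continuous B ∧ BoundedVariationOn B (Set.Icc 0 S) ∧
      (∀ t ≤ S, Tendsto (fun N => riemannSum (T.grid N) ξ X t) atTop
        (𝓝 (f (A t) (X t) - B t))) ∧
      ∃ K, ∀ᶠ N in atTop, ∑ i ∈ (T.grid N).steps S,
        |f (A ((T.grid N).pt (i + 1))) (X ((T.grid N).pt (i + 1)))
          - f (A ((T.grid N).pt i)) (X ((T.grid N).pt i))
          - inner ℝ (ξ ((T.grid N).pt i)) (X ((T.grid N).pt (i + 1)) - X ((T.grid N).pt i))|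
        ≤ K := by
  have hin : ∀ (N i : ℕ), (T.grid N).pt i ≤ S → ∀ v, inner ℝ (ξ ((T.grid N).pt i)) v =
      fderiv ℝ (f (A ((T.grid N).pt i))) (X ((T.grid N).pt i)) v := fun N i hi v => by
    rw [hξ _ hi, inner_gradient_left]
  obtain ⟨⟨K, hK⟩, J, hJc, hJ⟩ := exists_compensator hX hA hAv hf (w := _) fun N i => rfl
  -- The Riemann sums are the telescoping increments of f(A, X) minus the compensator sums; the
  -- constant f(A_0, X_0) is absorbed into B.
  refine ⟨fun t => f (A 0) (X 0) + J t, by fun_prop, ?_, fun t ht => ?_, K, ?_⟩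
  · have := boundedVariationOn_of_tendsto_sum T hK hJ
    refine ne_top_of_le_ne_top this (le_of_eq ?_)
    simp [eVariationOn, edist_add_left]
  · have hfc : Continuous fun s => f (A s) (X s) := hf.1.continuous.comp (hA.prodMk hX.1)
    have := (tendsto_sum_increments T ht hfc.continuousOn).sub (hJ t ht)
    rw [← sub_sub]
    refine this.congr fun N => ?_
    rw [riemannSum, ← Finset.sum_sub_distrib]
    refine Finset.sum_congr rfl fun i hi => ?_
    rw [hin N i ((TimeGrid.pt_le_of_mem_steps hi).trans ht)]
    ring
  · filter_upwards [hK] with N hN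
    refine le_trans (le_of_eq (Finset.sum_congr rfl fun i hi => ?_)) hN
    rw [hin N i (TimeGrid.pt_le_of_mem_steps hi)]

end Ito

/-! ### Admissibility of the combined integrand. -/

theorem IsC12Map.of_right {E F G : Type*} [NormedAddCommGroup E] [NormedSpace ℝ E]
    [NormedAddCommGroup F] [NormedSpace ℝ F] [NormedAddCommGroup G] [NormedSpace ℝ G]
    (L : F →L[ℝ] G) : IsC12Map fun (_ : E) (x : F) => L x :=
  isC12Map_iff_exists.2 ⟨by unfold Function.uncurry; fun_prop, fun _ _ => L, fun _ _ => 0,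
    fun _ _ => L.hasFDerivAt, fun _ _ => hasFDerivAt_const _ _, continuous_const⟩

/-- The coordinate map `ℝ^ι → ℝ^κ` induced by a map of index sets. -/
noncomputable def coordMap {ι κ : Type*} [Fintype ι] [Fintype κ] (g : κ → ι) :
    EuclideanSpace ℝ ι →L[ℝ] EuclideanSpace ℝ κ :=
  LinearMap.toContinuousLinearMap
    { toFun := fun v => WithLp.toLp 2 fun k => v (g k)
      map_add' := fun _ _ => rfl
      map_smul' := fun _ _ => rfl }

theorem coordMap_apply {ι κ : Type*} [Fintype ι] [Fintype κ] (g : κ → ι) (v : EuclideanSpace ℝ ι)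
    (k : κ) : coordMap g v k = v (g k) := rfl

/-- Admissibility may be tested with parameters indexed by any finite type. -/
theorem exists_fin_parameter {ι : Type*} [Fintype ι] {d : ℕ} {S : ℝ≥0}
    {X ξ : ℝ≥0 → EuclideanSpace ℝ (Fin d)}
    {f : EuclideanSpace ℝ ι → EuclideanSpace ℝ (Fin d) → ℝ} (hf : IsC12Map f)
    {A : ℝ≥0 → EuclideanSpace ℝ ι} (hA : Continuous A)
    (hAv : ∀ k, BoundedVariationOn (fun t => A t k) (Set.Icc 0 S))
    (hξ : ∀ t ≤ S, ξ t = gradient (f (A t)) (X t)) :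
    ∃ (n : ℕ) (f : EuclideanSpace ℝ (Fin n) → EuclideanSpace ℝ (Fin d) → ℝ)
      (A : ℝ≥0 → EuclideanSpace ℝ (Fin n)),
      IsC12 f ∧ Continuous A ∧
      (∀ k : Fin n, BoundedVariationOn (fun t => A t k) (Set.Icc 0 S)) ∧
      ∀ t, t ≤ S → ξ t = gradient (f (A t)) (X t) := by
  let e := Fintype.equivFin ι
  have he : ∀ v : EuclideanSpace ℝ ι, coordMap e (coordMap e.symm v) = v := fun v => by
    ext k
    simp [coordMap_apply]
  refine ⟨Fintype.card ι, fun a => f (coordMap e a), fun t => coordMap e.symm (A t),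
    hf.comp_left _, by fun_prop, fun k => ?_, fun t ht => ?_⟩
  · simpa only [coordMap_apply] using hAv (e.symm k)
  · simpa only [he] using hξ t ht

/-- Chain rule, tested against inner products. The constants c allow for the shift by -B, which the
x-gradient does not see. -/
theorem gradient_comp_eq_sum {F : Type*} [NormedAddCommGroup F] [InnerProductSpace ℝ F]
    [CompleteSpace F] {ν : ℕ} {g : EuclideanSpace ℝ (Fin ν) → ℝ}
    {Φ : F → EuclideanSpace ℝ (Fin ν)} {φ : Fin ν → F → ℝ} {c : Fin ν → ℝ}
    (hΦ : ∀ x ℓ, Φ x ℓ = φ ℓ x + c ℓ) {x : F}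
    (hg : DifferentiableAt ℝ g (Φ x)) (hφ : ∀ ℓ, DifferentiableAt ℝ (φ ℓ) x) :
    gradient (fun x => g (Φ x)) x = ∑ ℓ, gradient g (Φ x) ℓ • gradient (φ ℓ) x := by
  have hΦd : HasFDerivAt Φ (∑ ℓ, (fderiv ℝ (φ ℓ) x).smulRight
      (EuclideanSpace.single ℓ (1 : ℝ))) x := by
    rw [← hasFDerivWithinAt_univ, hasFDerivWithinAt_euclidean]
    intro k
    rw [hasFDerivWithinAt_univ]
    simp only [hΦ]
    refine ((hφ k).hasFDerivAt.add_const (c k)).congr_fderiv ?_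
    ext v
    simp
  refine ext_inner_right ℝ fun v => ?_
  have hcomp : HasFDerivAt (fun x => g (Φ x)) _ x := hg.hasFDerivAt.comp x hΦd
  rw [inner_gradient_left, sum_inner, hcomp.fderiv]
  simp only [real_inner_smul_left, inner_gradient_left, ContinuousLinearMap.comp_apply,
    sum_apply, ContinuousLinearMap.smulRight_apply, map_sum, map_smul,
    smul_eq_mul]
  refine Finset.sum_congr rfl fun ℓ _ => ?_
  have : gradient g (Φ x) ℓ = fderiv ℝ g (Φ x) (EuclideanSpace.single ℓ 1) := by
    rw [← inner_gradient_left, EuclideanSpace.inner_single_right]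
    simp
  rw [this, mul_comm]

/-- Composing `C^{1,2}` representations: if `Y = f (A, X) - B` and `η = ∇ g (C, Y)`, then
`∑ η ξ = ∇ h` for a `C^{1,2}` function of the joined parameters and `X`. -/
theorem exists_representation_sum_smul {d ν n : ℕ} {S : ℝ≥0}
    {X : ℝ≥0 → EuclideanSpace ℝ (Fin d)} {ξ : Fin ν → ℝ≥0 → EuclideanSpace ℝ (Fin d)}
    {Y η : ℝ≥0 → EuclideanSpace ℝ (Fin ν)} {q : Fin ν → ℕ}
    {f : ∀ ℓ, EuclideanSpace ℝ (Fin (q ℓ)) → EuclideanSpace ℝ (Fin d) → ℝ}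
    {A : ∀ ℓ, ℝ≥0 → EuclideanSpace ℝ (Fin (q ℓ))} {B : Fin ν → ℝ≥0 → ℝ}
    {g : EuclideanSpace ℝ (Fin n) → EuclideanSpace ℝ (Fin ν) → ℝ}
    {C : ℝ≥0 → EuclideanSpace ℝ (Fin n)}
    (hf : ∀ ℓ, IsC12Map (f ℓ)) (hA : ∀ ℓ, Continuous (A ℓ))
    (hAv : ∀ ℓ k, BoundedVariationOn (fun t => A ℓ t k) (Set.Icc 0 S))
    (hξ : ∀ ℓ, ∀ t ≤ S, ξ ℓ t = gradient (f ℓ (A ℓ t)) (X t))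
    (hB : ∀ ℓ, Continuous (B ℓ)) (hBv : ∀ ℓ, BoundedVariationOn (B ℓ) (Set.Icc 0 S))
    (hY : ∀ ℓ, ∀ t ≤ S, Y t ℓ = f ℓ (A ℓ t) (X t) - B ℓ t)
    (hg : IsC12Map g) (hC : Continuous C)
    (hCv : ∀ k, BoundedVariationOn (fun t => C t k) (Set.Icc 0 S))
    (hη : ∀ t ≤ S, η t = gradient (g (C t)) (Y t)) :
    ∃ (m : ℕ) (h : EuclideanSpace ℝ (Fin m) → EuclideanSpace ℝ (Fin d) → ℝ)
      (P : ℝ≥0 → EuclideanSpace ℝ (Fin m)),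
      IsC12 h ∧ Continuous P ∧
      (∀ k : Fin m, BoundedVariationOn (fun t => P t k) (Set.Icc 0 S)) ∧
      ∀ t, t ≤ S → ∑ ℓ, η t ℓ • ξ ℓ t = gradient (h (P t)) (X t) := by
  -- Joint parameters: those of g, those of all the f^ℓ, and the correction terms B^ℓ.
  let ι := Fin n ⊕ ((Σ ℓ, Fin (q ℓ)) ⊕ Fin ν)
  let πC : EuclideanSpace ℝ ι →L[ℝ] EuclideanSpace ℝ (Fin n) := coordMap Sum.inl
  let πA : ∀ ℓ, EuclideanSpace ℝ ι →L[ℝ] EuclideanSpace ℝ (Fin (q ℓ)) := fun ℓ =>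
    coordMap fun k => Sum.inr (Sum.inl ⟨ℓ, k⟩)
  let πB : EuclideanSpace ℝ ι →L[ℝ] EuclideanSpace ℝ (Fin ν) :=
    coordMap fun ℓ => Sum.inr (Sum.inr ℓ)
  -- The map (f^ℓ(a^ℓ, x) - b^ℓ)_ℓ, written as a sum of scaled basis vectors so that the closure
  -- rules for `C^{1,2}` maps apply.
  let Φ : EuclideanSpace ℝ ι → EuclideanSpace ℝ (Fin d) → EuclideanSpace ℝ (Fin ν) := fun p x =>
    ∑ ℓ, (ContinuousLinearMap.id ℝ ℝ).smulRight (EuclideanSpace.single ℓ (1 : ℝ))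
      (f ℓ (πA ℓ p) x) + (-πB) p
  have hΦ : IsC12Map Φ := (IsC12Map.sum _ fun ℓ _ =>
    (IsC12Map.of_right _).comp ((hf ℓ).comp_left (πA ℓ))).add (IsC12Map.of_left _)
  have hΦa : ∀ p x ℓ, Φ p x ℓ = f ℓ (πA ℓ p) x + -πB p ℓ := fun p x ℓ => by
    simp [Φ, Finset.sum_apply, Pi.single_apply]
  let P : ℝ≥0 → EuclideanSpace ℝ ι := fun t => WithLp.toLp 2
    (Sum.elim (fun k => C t k) (Sum.elim (fun k => A k.1 t k.2) (fun ℓ => B ℓ t)))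
  have hPC : ∀ t, πC (P t) = C t := fun t => rfl
  have hPA : ∀ t ℓ, πA ℓ (P t) = A ℓ t := fun t ℓ => rfl
  have hPB : ∀ t ℓ, πB (P t) ℓ = B ℓ t := fun t ℓ => rfl
  refine exists_fin_parameter (f := fun p x => g (πC p) (Φ p x)) (A := P)
    ((hg.comp_left πC).comp hΦ) ?_ ?_ fun t ht => ?_
  · refine (PiLp.continuous_toLp 2 _).comp (continuous_pi ?_)
    rintro (k | ⟨ℓ, k⟩ | ℓ)
    · change Continuous fun t => C t k
      fun_prop
    · change Continuous fun t => A ℓ t k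
      have := hA ℓ
      fun_prop
    · exact hB ℓ
  · rintro (k | ⟨ℓ, k⟩ | ℓ)
    · exact hCv k
    · exact hAv ℓ k
    · exact hBv ℓ
  · have hYΦ : Φ (P t) (X t) = Y t := by
      ext ℓ
      rw [hΦa, hPA, hPB, hY ℓ t ht, sub_eq_add_neg]
    rw [gradient_comp_eq_sum (g := g (πC (P t))) (Φ := Φ (P t)) (hΦa (P t))
      (hg.hasFDerivAt_right _ _).differentiableAt
      (fun ℓ => ((hf ℓ).hasFDerivAt_right _ _).differentiableAt), hYΦ, hPC, hη t ht]
    simp only [hPA]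
    exact Finset.sum_congr rfl fun ℓ _ => by rw [hξ ℓ t ht]

/-! ### Comparison of the two Riemann sums and conclusion. -/

theorem itoIntegral_zero (T : GridSequence) {d : ℕ} (ξ X : ℝ≥0 → EuclideanSpace ℝ (Fin d)) :
    itoIntegral T ξ X 0 = 0 := by
  simp only [itoIntegral, riemannSum, TimeGrid.steps_zero, Finset.sum_empty]
  exact tendsto_const_nhds.limUnder_eq

/-- The Itô decomposition of the integral of an admissible integrand. -/
theorem IsAdmissible.exists_decomposition {T : GridSequence} {d : ℕ}
    {X ξ : ℝ≥0 → EuclideanSpace ℝ (Fin d)} (hξ : IsAdmissible X ξ) (hX : IsIntegrator T X)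
    {S : ℝ≥0} (hS : 0 < S) :
    ∃ (n : ℕ) (f : EuclideanSpace ℝ (Fin n) → EuclideanSpace ℝ (Fin d) → ℝ)
      (A : ℝ≥0 → EuclideanSpace ℝ (Fin n)) (B : ℝ≥0 → ℝ),
      IsC12Map f ∧ Continuous A ∧
      (∀ k : Fin n, BoundedVariationOn (fun t => A t k) (Set.Icc 0 S)) ∧
      (∀ t ≤ S, ξ t = gradient (f (A t)) (X t)) ∧
      Continuous B ∧ BoundedVariationOn B (Set.Icc 0 S) ∧
      (∀ t ≤ S, Tendsto (fun N => riemannSum (T.grid N) ξ X t) atTop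
        (𝓝 (itoIntegral T ξ X t))) ∧
      (∀ t ≤ S, itoIntegral T ξ X t = f (A t) (X t) - B t) ∧
      ∃ K, ∀ᶠ N in atTop, ∑ i ∈ (T.grid N).steps S,
        |itoIntegral T ξ X ((T.grid N).pt (i + 1)) - itoIntegral T ξ X ((T.grid N).pt i)
          - inner ℝ (ξ ((T.grid N).pt i)) (X ((T.grid N).pt (i + 1)) - X ((T.grid N).pt i))|
        ≤ K := by
  obtain ⟨n, f, A, hf, hA, hAv, hξ⟩ := hξ S hS
  obtain ⟨B, hB, hBv, hlim, K, hK⟩ := exists_ito_decomposition hX hA hAv hf hξ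
  have hI : ∀ t ≤ S, itoIntegral T ξ X t = f (A t) (X t) - B t := fun t ht =>
    (hlim t ht).limUnder_eq
  -- Increments of the integral differ from those of f(A, X) by increments of B, which adds the
  -- variation of B to the bound.
  refine ⟨n, f, A, B, hf, hA, hAv, hξ, hB, hBv, fun t ht => ?_, hI,
    K + (eVariationOn B (Set.Icc 0 S)).toReal, ?_⟩
  · rw [hI t ht]
    exact hlim t ht
  · filter_upwards [hK] with N hN
    refine le_trans ?_ (add_le_add hN ((T.grid N).sum_abs_increments_le hBv))
    rw [← Finset.sum_add_distrib]
    refine Finset.sum_le_sum fun i hi => ?_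
    rw [hI _ (TimeGrid.mem_steps.1 hi), hI _ (TimeGrid.pt_le_of_mem_steps hi)]
    refine le_trans (le_of_eq ?_) (abs_sub _ _)
    congr 1
    ring

/-- Riemann sums of `η` against `Y = ∫ ξ dX` are asymptotic to those of `∑ η ξ` against `X`. -/
theorem tendsto_riemannSum_sub_zero {T : GridSequence} {d ν : ℕ}
    {X : ℝ≥0 → EuclideanSpace ℝ (Fin d)} {ξ : Fin ν → ℝ≥0 → EuclideanSpace ℝ (Fin d)}
    {Y η : ℝ≥0 → EuclideanSpace ℝ (Fin ν)} {S : ℝ≥0}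
    (hY : ∀ ℓ, ContinuousOn (fun t => Y t ℓ) (Set.Icc 0 S)) (hY0 : ∀ ℓ, Y 0 ℓ = 0)
    (hlim : ∀ ℓ, ∀ t ≤ S, Tendsto (fun N => riemannSum (T.grid N) (ξ ℓ) X t) atTop (𝓝 (Y t ℓ)))
    (hK : ∀ ℓ, ∃ K, ∀ᶠ N in atTop, ∑ i ∈ (T.grid N).steps S,
        |Y ((T.grid N).pt (i + 1)) ℓ - Y ((T.grid N).pt i) ℓ
          - inner ℝ (ξ ℓ ((T.grid N).pt i)) (X ((T.grid N).pt (i + 1)) - X ((T.grid N).pt i))|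
        ≤ K)
    (hη : ∀ ℓ, ContinuousOn (fun t => η t ℓ) (Set.Icc 0 S)) {t : ℝ≥0} (ht : t ≤ S) :
    Tendsto (fun N => riemannSum (T.grid N) η Y t
      - riemannSum (T.grid N) (fun s => ∑ ℓ, η s ℓ • ξ ℓ s) X t) atTop (𝓝 0) := by
  have h : ∀ ℓ, Tendsto (fun N => ∑ i ∈ (T.grid N).steps t, η ((T.grid N).pt i) ℓ *
      (Y ((T.grid N).pt (i + 1)) ℓ - Y ((T.grid N).pt i) ℓ
        - inner ℝ (ξ ℓ ((T.grid N).pt i)) (X ((T.grid N).pt (i + 1)) - X ((T.grid N).pt i))))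
      atTop (𝓝 0) := by
    intro ℓ
    obtain ⟨K, hK⟩ := hK ℓ
    refine tendsto_weightedSum_zero T (hη ℓ) hK (fun s hs => ?_) ht
    -- The telescoped increments of Y^ℓ and the Riemann sums of ξ^ℓ have the same limit Y^ℓ_s,
    -- because Y^ℓ vanishes at 0.
    have := (tendsto_sum_increments T hs (hY ℓ)).sub (hlim ℓ s hs)
    rw [hY0, sub_zero, sub_self] at this
    refine this.congr fun N => ?_
    rw [riemannSum, ← Finset.sum_sub_distrib]
  have hs := tendsto_finsetSum Finset.univ fun ℓ _ => h ℓ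
  rw [Finset.sum_const_zero] at hs
  refine hs.congr fun N => ?_
  rw [riemannSum, riemannSum, ← Finset.sum_sub_distrib, Finset.sum_comm]
  refine Finset.sum_congr rfl fun i _ => ?_
  rw [sum_inner, PiLp.inner_apply, ← Finset.sum_sub_distrib]
  refine Finset.sum_congr rfl fun ℓ _ => ?_
  rw [real_inner_smul_left]
  simp only [PiLp.sub_apply, RCLike.inner_apply, conj_trivial]
  ring

end PathwiseIto

open PathwiseIto
theorem theorem5 (T : GridSequence) {d ν : ℕ}
    (X : ℝ≥0 → EuclideanSpace ℝ (Fin d)) (hX : IsIntegrator T X)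
    (ξ : Fin ν → ℝ≥0 → EuclideanSpace ℝ (Fin d)) (hξ : ∀ ℓ, IsAdmissible X (ξ ℓ))
    (Y : ℝ≥0 → EuclideanSpace ℝ (Fin ν)) (hY : ∀ ℓ t, Y t ℓ = itoIntegral T (ξ ℓ) X t)
    (η : ℝ≥0 → EuclideanSpace ℝ (Fin ν)) (hη : IsAdmissible Y η) :
    (∀ ℓ, ItoIntegrable T (ξ ℓ) X) ∧
    IsAdmissible X (fun t => ∑ ℓ, η t ℓ • ξ ℓ t) ∧
    ItoIntegrable T η Y ∧
    ItoIntegrable T (fun t => ∑ ℓ, η t ℓ • ξ ℓ t) X ∧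
    ∀ t, itoIntegral T η Y t = itoIntegral T (fun s => ∑ ℓ, η s ℓ • ξ ℓ s) X t := by
  have hint : ∀ {ζ : ℝ≥0 → EuclideanSpace ℝ (Fin d)}, IsAdmissible X ζ → ∀ t,
      Tendsto (fun N => riemannSum (T.grid N) ζ X t) atTop (𝓝 (itoIntegral T ζ X t)) := by
    intro ζ hζ t
    obtain ⟨-, -, -, -, -, -, -, -, -, -, h, -⟩ :=
      -- The horizon t + 1 is positive even for t = 0, as admissibility requires.
      hζ.exists_decomposition hX (show 0 < t + 1 by positivity)
    exact h t le_self_add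
  have hadm : IsAdmissible X (fun t => ∑ ℓ, η t ℓ • ξ ℓ t) := by
    intro S hS
    choose n f A B hf hA hAv hξ hB hBv _ hI _ using
      fun ℓ => (hξ ℓ).exists_decomposition hX hS
    obtain ⟨m, g, C, hg, hC, hCv, hη⟩ := hη S hS
    exact exists_representation_sum_smul hf hA hAv hξ hB hBv
      (fun ℓ t ht => (hY ℓ t).trans (hI ℓ t ht)) hg hC hCv hη
  have hlim : ∀ t, Tendsto (fun N => riemannSum (T.grid N) η Y t) atTop
      (𝓝 (itoIntegral T (fun s => ∑ ℓ, η s ℓ • ξ ℓ s) X t)) := by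
    intro t
    have hS : 0 < t + 1 := by positivity
    choose n f A B hf hA hAv _ hB _ _ hI hK using
      fun ℓ => (hξ ℓ).exists_decomposition hX hS
    obtain ⟨m, g, C, hg, hC, hCv, hη⟩ := hη _ hS
    have hYc : ∀ ℓ, ContinuousOn (fun s => Y s ℓ) (Set.Icc 0 (t + 1)) := by
      intro ℓ
      have : Continuous fun s => f ℓ (A ℓ s) (X s) - B ℓ s :=
        ((hf ℓ).1.continuous.comp ((hA ℓ).prodMk hX.1)).sub (hB ℓ)
      exact this.continuousOn.congr fun s hs => (hY ℓ s).trans (hI ℓ s hs.2)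
    have hYc' : ContinuousOn Y (Set.Icc 0 (t + 1)) :=
      (PiLp.continuous_toLp 2 _).comp_continuousOn (continuousOn_pi.2 hYc)
    -- The x-gradient of g is jointly continuous, and it is evaluated along the continuous paths C
    -- and Y.
    have hηc : ContinuousOn η (Set.Icc 0 (t + 1)) := by
      have h1 : Continuous fun p : EuclideanSpace ℝ (Fin m) × EuclideanSpace ℝ (Fin ν) =>
          gradient (g p.1) p.2 :=
        (InnerProductSpace.toDual ℝ _).symm.continuous.comp
          (IsC12Map.continuous_fderiv_right hg)
      exact (h1.comp_continuousOn (hC.continuousOn.prodMk hYc')).congr fun s hs => hη s hs.2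
    have h := tendsto_riemannSum_sub_zero (T := T) (X := X) (ξ := ξ) (Y := Y) (η := η) hYc
      (fun ℓ => (hY ℓ 0).trans (itoIntegral_zero T _ _))
      (fun ℓ s _ => by rw [hY]; exact hint (hξ ℓ) s)
      (fun ℓ => by simpa only [hY] using hK ℓ)
      (fun ℓ => by fun_prop) (le_self_add : t ≤ t + 1)
    simpa using h.add (hint hadm t)
  exact ⟨fun ℓ t => ⟨_, hint (hξ ℓ) t⟩, hadm, fun t => ⟨_, hlim t⟩, fun t => ⟨_, hint hadm t⟩,
    fun t => (hlim t).limUnder_eq⟩
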